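/- Let $M$ be an $m$-dimensional (Hausdorff) $C^\infty$ manifold, let $n\ge 3$, and let $P\in\Gamma(\bigwedge^n TM)$ be a $C^\infty$ $n$-vector field, i.e. a completely skew-symmetric contravariant tensor field of order $n$. For $f_1,\dots,f_n\in C^\infty(M)$ put $\{f_1,\dots,f_n\}=P(df_1,\dots,df_n)$. One says that $P$ defines an $n$-ary Poisson bracket if this bracket satisfies the generalized Jacobi identity of order $n$, $$\sum_{\sigma\in S_{2n-1}}(\operatorname{sign}\sigma)\,\{\{f_{\sigma_1},\dots,f_{\sigma_n}\},f_{\sigma_{n+1}},\dots,f_{\sigma_{2n-1}}\}=0\qquad\text{for all } f_1,\dots,f_{2n-1}\in C^\infty(M).$$ Let $\mathcal A$ be any family of $C^\infty$ charts of $M$ whose domains cover $M$. Then $P$ defines an $n$-ary Poisson bracket if and only if either $n$ is even and the Schouten–Nijenhuis bracket $[P,P]$ vanishes, or $n$ is odd and $P$ satisfies both $$(A)\qquad (i(\alpha)P)\wedge(i(\beta)P)=0\qquad\text{for all } x\in M,\ \alpha,\beta\in T_x^*M,$$ $$(D)\qquad \sum_{u=1}^m (i(dx^u)P)\wedge(L_{\partial/\partial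 x^u}P)=0\qquad\text{on the domain of every chart }(x^1,\dots,x^m)\text{ in }\mathcal A .$$ Here $i(\cdot)$ denotes contraction with a covector and $L$ the Lie derivative. -/

import Mathlib

open scoped Manifold ContDiff

noncomputable section

namespace NaryPoisson

/-! ### Multilinear algebra

An `n`-vector over a real vector space `V` is a completely skew-symmetric contravariant tensor, i.e.
an alternating `n`-linear form on the dual `V →L[ℝ] ℝ`. -/

section Algebra

variable {V : Type*} [AddCommGroup V] [Module ℝ V] [TopologicalSpace V]

/-- The decomposable `n`-vector `v₁ ∧ ⋯ ∧ vₙ`, with value `det (αᵢ (vⱼ))` on `(α₁, …, αₙ)`. -/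
def wedgeVec {n : ℕ} (v : Fin n → V) :
    (V →L[ℝ] ℝ) [⋀^Fin n]→ₗ[ℝ] ℝ :=
  (Matrix.detRowAlternating (R := ℝ) (n := Fin n)).compLinearMap
    (LinearMap.pi fun j =>
      { toFun := fun α : V →L[ℝ] ℝ => α (v j)
        map_add' := fun _ _ => rfl
        map_smul' := fun _ _ => rfl })

/-- The wedge product of a `p`-vector and a `q`-vector (the sum over `(p, q)`-shuffles). -/
def wedge {p q : ℕ} (a : (V →L[ℝ] ℝ) [⋀^Fin p]→ₗ[ℝ] ℝ) (b : (V →L[ℝ] ℝ) [⋀^Fin q]→ₗ[ℝ] ℝ) :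
    (V →L[ℝ] ℝ) [⋀^Fin (p + q)]→ₗ[ℝ] ℝ :=
  ((LinearMap.mul' ℝ ℝ).compAlternatingMap (a.domCoprod b)).domDomCongr finSumFinEquiv

/-- The contraction `i(α)P` of an `(n+1)`-vector with a covector: insert `α` in the first slot. -/
def contract {n : ℕ} (α : V →L[ℝ] ℝ) (P : (V →L[ℝ] ℝ) [⋀^Fin (n + 1)]→ₗ[ℝ] ℝ) :
    (V →L[ℝ] ℝ) [⋀^Fin n]→ₗ[ℝ] ℝ :=
  P.curryLeft α

end Algebra

/-! ### Multivector fields on `ℝᵐ` -/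

section Euclidean

variable {m : ℕ}

/-- `ℝᵐ`. -/
abbrev Euc (m : ℕ) : Type := EuclideanSpace ℝ (Fin m)

/-- The coordinate covector `dxᵘ` on `ℝᵐ`. -/
def dx (u : Fin m) : Euc m →L[ℝ] ℝ := EuclideanSpace.proj u

/-- The coordinate vector `∂/∂xᵘ` on `ℝᵐ`. -/
def ddx (u : Fin m) : Euc m := EuclideanSpace.single u 1

/-- The Lie derivative of an `n`-vector field `P` on (an open subset of) `ℝᵐ` along a vector field
`X`, at the point `y`:
`(L_X P)(α₁, …, αₙ) = X(P(α₁, …, αₙ)) - ∑ᵢ P(α₁, …, L_X αᵢ, …, αₙ)` for constant covectors `αᵢ`,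
for which `L_X αᵢ = αᵢ ∘ DX`. -/
def lieDeriv {n : ℕ} (X : Euc m → Euc m)
    (P : Euc m → (Euc m →L[ℝ] ℝ) [⋀^Fin n]→L[ℝ] ℝ) (y : Euc m) :
    (Euc m →L[ℝ] ℝ) [⋀^Fin n]→L[ℝ] ℝ :=
  fderiv ℝ P y (X y) -
    (P y).fderivCompContinuousLinearMap (ContinuousLinearMap.id ℝ (Euc m →L[ℝ] ℝ))
      (ContinuousLinearMap.precomp ℝ (fderiv ℝ X y))

/-- The Schouten–Nijenhuis bracket of two decomposable multivector fields on `ℝᵐ`, at `y`: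
`[X₀ ∧ ⋯ ∧ X_p, Y₀ ∧ ⋯ ∧ Y_q]
  = ∑ᵢⱼ (-1)^(i+j) [Xᵢ, Yⱼ] ∧ X₀ ∧ ⋯ X̂ᵢ ⋯ ∧ X_p ∧ Y₀ ∧ ⋯ Ŷⱼ ⋯ ∧ Y_q`. -/
def schoutenDecomposable {p q : ℕ} (X : Fin (p + 1) → Euc m → Euc m)
    (Y : Fin (q + 1) → Euc m → Euc m) (y : Euc m) :
    (Euc m →L[ℝ] ℝ) [⋀^Fin (p + q + 1)]→ₗ[ℝ] ℝ :=
  ∑ i : Fin (p + 1), ∑ j : Fin (q + 1), (-1 : ℝ) ^ ((i : ℕ) + (j : ℕ)) •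
    wedgeVec (Fin.cons (VectorField.lieBracket ℝ (X i) (Y j) y)
      (Fin.append (fun a : Fin p => X (i.succAbove a) y) (fun b : Fin q => Y (j.succAbove b) y)))

/-- The vector fields `P^I ∂_{I 0}, ∂_{I 1}, …, ∂_{I p}`, where `P^I = P(dx^{I 0}, …, dx^{I p})`.
The sum over increasing multi-indices `I` of their wedge products is `P`. -/
def monomialFactors {p : ℕ} (P : Euc m → (Euc m →L[ℝ] ℝ) [⋀^Fin (p + 1)]→L[ℝ] ℝ)
    (I : Fin (p + 1) ↪o Fin m) : Fin (p + 1) → Euc m → Euc m :=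
  Fin.cons (fun y => P y (fun a => dx (I a)) • ddx (I 0)) (fun a _ => ddx (I a.succ))

/-- The Schouten–Nijenhuis bracket of two multivector fields on `ℝᵐ`, at `y`: the biadditive
extension of the bracket of decomposable ones. -/
def schoutenEuc {p q : ℕ} (P : Euc m → (Euc m →L[ℝ] ℝ) [⋀^Fin (p + 1)]→L[ℝ] ℝ)
    (Q : Euc m → (Euc m →L[ℝ] ℝ) [⋀^Fin (q + 1)]→L[ℝ] ℝ) (y : Euc m) :
    (Euc m →L[ℝ] ℝ) [⋀^Fin (p + q + 1)]→ₗ[ℝ] ℝ :=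
  ∑ I : Fin (p + 1) ↪o Fin m, ∑ J : Fin (q + 1) ↪o Fin m,
    schoutenDecomposable (monomialFactors P I) (monomialFactors Q J) y

end Euclidean

/-! ### Multivector fields on manifolds -/

section Manifold

variable {m : ℕ} {M : Type*} [TopologicalSpace M] [ChartedSpace (Euc m) M]

/-- The cotangent space `T*ₓM`. -/
abbrev Cotangent (m : ℕ) {M : Type*} [TopologicalSpace M] [ChartedSpace (Euc m) M] (x : M) : Type :=
  TangentSpace (𝓡 m) x →L[ℝ] ℝ

/-- The expression in the chart `φ` of a (not necessarily smooth) field `P` of `n`-vectors: at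
`y = φ x` it is the push-forward of `P x` under the differential of `φ` at `x`. -/
def inChart {n : ℕ} (P : ∀ x : M, Cotangent m x [⋀^Fin n]→L[ℝ] ℝ)
    (φ : OpenPartialHomeomorph M (Euc m)) (y : Euc m) : (Euc m →L[ℝ] ℝ) [⋀^Fin n]→L[ℝ] ℝ :=
  (P (φ.symm y)).compContinuousLinearMap
    (ContinuousLinearMap.precomp ℝ (mvfderiv (𝓡 m) φ (φ.symm y)))

variable (m M) in
/-- A smooth `n`-vector field on the manifold `M`, i.e. a smooth section of `⋀ⁿ TM`. -/
structure MultivectorField (n : ℕ) where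
  /-- The value at each point. -/
  toFun : ∀ x : M, Cotangent m x [⋀^Fin n]→L[ℝ] ℝ
  /-- In every chart the coordinate expression is `C^∞`. -/
  smooth : ∀ φ ∈ IsManifold.maximalAtlas (𝓡 m) ∞ M, ContDiffOn ℝ ∞ (inChart toFun φ) φ.target

/-- The bracket `{f₁, …, fₙ} = P(df₁, …, dfₙ)`. -/
def bracket {n : ℕ} (P : MultivectorField m M n) (f : Fin n → M → ℝ) (x : M) : ℝ :=
  P.toFun x (fun i => mvfderiv (𝓡 m) (f i) x)

/-- `P`, of order `n = k + 1`, defines an `n`-ary Poisson bracket on `C^∞(M)`: the bracket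
satisfies the generalized Jacobi identity for all `2n - 1 = (k + 1) + k` smooth functions. -/
def DefinesPoissonBracket {k : ℕ} (P : MultivectorField m M (k + 1)) : Prop :=
  ∀ f : Fin (k + 1 + k) → C^∞⟮𝓡 m, M; ℝ⟯, ∀ x : M,
    ∑ σ : Equiv.Perm (Fin (k + 1 + k)), ((Equiv.Perm.sign σ : ℤ) : ℝ) *
      bracket P (Fin.cons (bracket P (fun i : Fin (k + 1) => ⇑(f (σ (Fin.castAdd k i)))))
        (fun j : Fin k => ⇑(f (σ (Fin.natAdd (k + 1) j))))) x = 0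

/-- The Schouten–Nijenhuis bracket of two multivector fields on a manifold. As for the Lie bracket
of vector fields, it is computed at `x` in the preferred chart at `x` and transported back to `TₓM`
by the inverse of the differential of the chart. -/
def schouten {p q : ℕ} (P : MultivectorField m M (p + 1)) (Q : MultivectorField m M (q + 1))
    (x : M) : Cotangent m x [⋀^Fin (p + q + 1)]→ₗ[ℝ] ℝ :=
  (schoutenEuc (inChart P.toFun (chartAt (Euc m) x)) (inChart Q.toFun (chartAt (Euc m) x))
    (chartAt (Euc m) x x)).compLinearMap
      (ContinuousLinearMap.precomp ℝ
        (mvfderiv (𝓡 m) (chartAt (Euc m) x) x).inverse).toLinearMap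

/-- Condition (A): `(i(α)P) ∧ (i(β)P) = 0` for all covectors `α`, `β` at the same point. -/
def AlgebraicCondition {k : ℕ} (P : MultivectorField m M (k + 1)) : Prop :=
  ∀ (x : M) (α β : Cotangent m x),
    wedge (contract α (P.toFun x).toAlternatingMap) (contract β (P.toFun x).toAlternatingMap) = 0

/-- Condition (D) in the local coordinates `(xᵘ)` given by the chart `φ`:
`∑ᵤ (i(dxᵘ)P) ∧ (L_{∂/∂xᵘ} P) = 0` on the domain of `φ`. -/
def DifferentialCondition {k : ℕ} (P : MultivectorField m M (k + 1))
    (φ : OpenPartialHomeomorph M (Euc m)) : Prop :=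
  ∀ y ∈ φ.target,
    ∑ u : Fin m, wedge (contract (dx u) (inChart P.toFun φ y).toAlternatingMap)
      (lieDeriv (fun _ => ddx u) (inChart P.toFun φ) y).toAlternatingMap = 0

end Manifold

end NaryPoisson

end

open scoped Manifold ContDiff

noncomputable section

namespace NaryPoisson

/-! Write k = n - 1. In a chart, the product rule splits the derivative of the inner bracket along
∂_u into (∂_u P)(df, …) and terms in which one df_i is replaced by the u-th row of its Hessian; the
outer bracket pairs this with P(dx^u, …). The Jacobi sum at a point therefore depends only on first
and second derivatives of the functions (`jacobiSum_symm_eq`). Cutting off quadratic polynomials by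
bump functions realizes all differentials and all symmetric Hessians independently (`exists_germ`),
so the identity at a point amounts to the vanishing of `jacobiator` on all such data.

The first-order part is, up to a nonzero factor, ∑_u ∂_u P ∧ i(dx^u)P, which is (D) with the factors
exchanged. The Hessian part is a signed sum, over the functions, of the Hessian contracted with (u,
w) ↦ i(dx^w)P ∧ i(dx^u)P (`jacobiator_eq_of_hessian`). Exchanging two k-vectors costs (-1)^k. For k
odd this array is skew and symmetric Hessians annihilate it (`jacobiator_of_odd`); for k even it is
symmetric, and testing one Hessian at a time forces (A) (`jacobiator_of_even_iff`).

For k odd, expanding P into monomials P^I ∂_I shows that [P, P] is -2 times the same first-order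
expression, up to relabelling the arguments (`schoutenEuc_self_apply`). Since the Jacobi identity at
a point mentions no chart, it may be tested in any one chart around that point; hence the freedom in
the choice of the covering family. -/

theorem alternatingMap_sum_apply {A ι κ : Type*} [AddCommGroup A] [Module ℝ A] [Fintype κ]
    (f : κ → A [⋀^ι]→ₗ[ℝ] ℝ) (v : ι → A) : (∑ u, f u) v = ∑ u, f u v :=
  map_sum (⟨⟨fun f => f v, rfl⟩, fun _ _ => rfl⟩ : (A [⋀^ι]→ₗ[ℝ] ℝ) →+ ℝ) _ _

/-! ### Antisymmetrized products and their commutation sign -/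

section AltSum

variable {A : Type*} {p q : ℕ}

/-- The full antisymmetrization of `F ⊗ G`, without normalization. -/
def altSum (F : (Fin p → A) → ℝ) (G : (Fin q → A) → ℝ) (v : Fin (p + q) → A) : ℝ :=
  ∑ σ : Equiv.Perm (Fin (p + q)), ((Equiv.Perm.sign σ : ℤ) : ℝ) *
    (F (fun i => v (σ (Fin.castAdd q i))) * G (fun j => v (σ (Fin.natAdd p j))))

theorem altSum_comp_perm (F : (Fin p → A) → ℝ) (G : (Fin q → A) → ℝ) (v : Fin (p + q) → A)
    (τ : Equiv.Perm (Fin (p + q))) :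
    altSum F G (v ∘ τ) = ((Equiv.Perm.sign τ : ℤ) : ℝ) * altSum F G v := by
  unfold altSum
  rw [Finset.mul_sum]
  refine Fintype.sum_equiv (Equiv.mulLeft τ) _ _ fun σ => ?_
  have h : ((Equiv.Perm.sign τ : ℤ) : ℝ) * ((Equiv.Perm.sign τ : ℤ) : ℝ) = 1 := by
    rw [← Int.cast_mul, ← Units.val_mul, Int.units_mul_self]; simp
  simp only [Equiv.coe_mulLeft, Equiv.Perm.sign_mul, Units.val_mul, Int.cast_mul,
    Function.comp_apply, Equiv.Perm.mul_apply]
  rw [mul_assoc, ← mul_assoc ((Equiv.Perm.sign τ : ℤ) : ℝ) ((Equiv.Perm.sign τ : ℤ) : ℝ), h,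
    one_mul]

theorem altSum_swap (F : (Fin p → A) → ℝ) (G : (Fin q → A) → ℝ) (v : Fin (p + q) → A) :
    altSum F G v = altSum G F (v ∘ (finAddFlip : Fin (q + p) ≃ Fin (p + q))) := by
  unfold altSum
  rw [← Equiv.sum_comp (Equiv.permCongr (finAddFlip : Fin (q + p) ≃ Fin (p + q)))]
  refine Finset.sum_congr rfl fun σ _ => ?_
  rw [Equiv.Perm.sign_permCongr]
  have h1 (i) : (finAddFlip : Fin (q + p) ≃ Fin (p + q)).symm (Fin.castAdd q i) =
      Fin.natAdd q i := by rw [Equiv.symm_apply_eq]; simp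
  have h2 (i) : (finAddFlip : Fin (q + p) ≃ Fin (p + q)).symm (Fin.natAdd p i) =
      Fin.castAdd p i := by rw [Equiv.symm_apply_eq]; simp
  rw [mul_comm (F _)]
  simp [Equiv.permCongr_apply, h1, h2]

/-- Under the identification with `Fin k × Bool`, the block exchange negates the Boolean, so it is a
product of k disjoint transpositions. -/
theorem sign_finAddFlip (k : ℕ) :
    Equiv.Perm.sign (finAddFlip : Equiv.Perm (Fin (k + k))) = (-1) ^ k := by
  let e : Fin k × Bool ≃ Fin (k + k) :=
    ((Equiv.prodComm _ _).trans (Equiv.boolProdEquivSum _)).trans finSumFinEquiv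
  have h : (finAddFlip : Equiv.Perm (Fin (k + k))) =
      e.permCongr (Equiv.prodCongrRight fun _ => Equiv.boolNot) := by
    ext x
    obtain ⟨⟨i, b⟩, rfl⟩ := e.surjective x
    rw [Equiv.permCongr_apply, Equiv.symm_apply_apply]
    cases b
    · simp [e, Equiv.boolProdEquivSum, -Fin.natAdd_eq_addNat]
    · simp [e, Equiv.boolProdEquivSum, -Fin.natAdd_eq_addNat]
  rw [h, Equiv.Perm.sign_permCongr, Equiv.Perm.sign_prodCongrRight]
  have : Equiv.Perm.sign Equiv.boolNot = -1 := by decide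
  simp [this]

theorem altSum_comm {k : ℕ} (F G : (Fin k → A) → ℝ) (v : Fin (k + k) → A) :
    altSum F G v = (-1) ^ k * altSum G F v := by
  rw [altSum_swap, altSum_comp_perm, sign_finAddFlip]
  simp

end AltSum

/-! ### Wedge products as antisymmetrizations -/

section Wedge

variable {V : Type*} [AddCommGroup V] [Module ℝ V] [TopologicalSpace V] {p q : ℕ}

/-- Each shuffle is counted once for every permutation within its two blocks. Since the factor is
nonzero, vanishing of wedges can be tested on `altSum`, where permutations are easier to handle than
shuffle classes. -/
theorem factorial_mul_wedge (a : (V →L[ℝ] ℝ) [⋀^Fin p]→ₗ[ℝ] ℝ) (b : (V →L[ℝ] ℝ) [⋀^Fin q]→ₗ[ℝ] ℝ)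
    (v : Fin (p + q) → V →L[ℝ] ℝ) :
    ((p.factorial * q.factorial : ℕ) : ℝ) * wedge a b v = altSum a b v := by
  have h := congrArg (fun f => LinearMap.mul' ℝ ℝ (f (v ∘ finSumFinEquiv)))
    (MultilinearMap.domCoprod_alternization_eq a b)
  simp only [Fintype.card_fin, AlternatingMap.smul_apply, map_nsmul] at h
  rw [← nsmul_eq_mul]
  refine Eq.trans h.symm ?_
  rw [MultilinearMap.alternatization_apply, map_sum]
  unfold altSum
  rw [← Equiv.sum_comp (Equiv.permCongr (finSumFinEquiv (m := p) (n := q)))]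
  refine Finset.sum_congr rfl fun σ _ => ?_
  rw [Equiv.Perm.sign_permCongr]
  rw [Units.smul_def, map_zsmul, zsmul_eq_mul]
  simp [Equiv.permCongr_apply, MultilinearMap.domDomCongr_apply]

theorem sum_wedge_eq_zero_iff {ι : Type*} [Fintype ι] (a : ι → (V →L[ℝ] ℝ) [⋀^Fin p]→ₗ[ℝ] ℝ)
    (b : ι → (V →L[ℝ] ℝ) [⋀^Fin q]→ₗ[ℝ] ℝ) :
    ∑ u, wedge (a u) (b u) = 0 ↔ ∀ v, ∑ u, altSum (a u) (b u) v = 0 := by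
  simp only [← factorial_mul_wedge, ← Finset.mul_sum, alternatingMap_sum_apply, AlternatingMap.ext_iff,
    AlternatingMap.zero_apply, mul_eq_zero, Nat.cast_eq_zero,
    Nat.factorial_ne_zero, false_or]

theorem wedge_eq_zero_iff (a : (V →L[ℝ] ℝ) [⋀^Fin p]→ₗ[ℝ] ℝ) (b : (V →L[ℝ] ℝ) [⋀^Fin q]→ₗ[ℝ] ℝ) :
    wedge a b = 0 ↔ ∀ v, altSum a b v = 0 := by
  simpa using sum_wedge_eq_zero_iff (ι := Unit) (fun _ => a) (fun _ => b)

end Wedge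

/-! ### The pointwise Jacobiator: first-order part and Hessian part -/

section Jacobiator

variable {A : Type*} [AddCommGroup A] [Module ℝ A] {k m : ℕ}

/-- The Jacobiator at a point of an `n`-vector `P` with partial derivatives `P' u`, on functions
with differentials `v l` and Hessians `H l`; the covectors `d u` are the coordinate differentials. -/
def jacobiator (P : A [⋀^Fin (k + 1)]→ₗ[ℝ] ℝ) (P' : Fin m → A [⋀^Fin (k + 1)]→ₗ[ℝ] ℝ)
    (d : Fin m → A) (v : Fin (k + 1 + k) → A) (H : Fin (k + 1 + k) → Fin m → A) : ℝ :=
  ∑ σ : Equiv.Perm (Fin (k + 1 + k)), ((Equiv.Perm.sign σ : ℤ) : ℝ) *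
    ∑ u, (P' u (fun i => v (σ (Fin.castAdd k i))) +
      ∑ i, P (Function.update (fun i => v (σ (Fin.castAdd k i))) i (H (σ (Fin.castAdd k i)) u))) *
      P (Fin.cons (d u) fun j => v (σ (Fin.natAdd (k + 1) j)))

/-- `Fin (2k + 1)` with the first point split off. -/
def splitFirst (k : ℕ) : Fin (k + k + 1) ≃ Fin (k + 1 + k) := finCongr (by omega)

/-- The points of `Fin (2k + 1)` other than the first, with `p` exchanged with the first. -/
def others {k : ℕ} (p : Fin (k + k + 1)) (i : Fin (k + k)) : Fin (k + 1 + k) :=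
  splitFirst k (Equiv.swap 0 p i.succ)

theorem splitFirst_symm_zero : (splitFirst k).symm (Fin.castAdd k 0) = 0 := by
  apply Fin.ext; simp [splitFirst]

theorem splitFirst_symm_succ (i : Fin k) :
    (splitFirst k).symm (Fin.castAdd k i.succ) = (Fin.castAdd k i).succ := by
  apply Fin.ext; simp [splitFirst]

theorem splitFirst_symm_natAdd (j : Fin k) :
    (splitFirst k).symm (Fin.natAdd (k + 1) j) = (Fin.natAdd k j).succ := by
  apply Fin.ext; simp [splitFirst]; omega

/-- The part of the Jacobiator containing second derivatives. -/
theorem jacobiator_hessian_part (P : A [⋀^Fin (k + 1)]→ₗ[ℝ] ℝ)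
    (d : A) (v : Fin (k + 1 + k) → A) (H : Fin (k + 1 + k) → A) :
    ∑ σ : Equiv.Perm (Fin (k + 1 + k)), ((Equiv.Perm.sign σ : ℤ) : ℝ) *
      ((∑ i, P (Function.update (fun i => v (σ (Fin.castAdd k i))) i (H (σ (Fin.castAdd k i))))) *
      P (Fin.cons d fun j => v (σ (Fin.natAdd (k + 1) j)))) =
    (k + 1) * ∑ p : Fin (k + k + 1), (if p = 0 then 1 else -1) *
      altSum (P.curryLeft (H (splitFirst k p))) (P.curryLeft d) (fun i => v (others p i)) := by
  -- Reindexing by the transposition of slots i and 0 changes both the sign of the permutation and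
  -- the sign of P, so all k + 1 slots contribute equally.
  have key (i : Fin (k + 1)) : ∑ σ : Equiv.Perm (Fin (k + 1 + k)), ((Equiv.Perm.sign σ : ℤ) : ℝ) *
      (P (Function.update (fun i => v (σ (Fin.castAdd k i))) i (H (σ (Fin.castAdd k i)))) *
      P (Fin.cons d fun j => v (σ (Fin.natAdd (k + 1) j)))) =
      ∑ σ : Equiv.Perm (Fin (k + 1 + k)), ((Equiv.Perm.sign σ : ℤ) : ℝ) *
      (P (Function.update (fun i => v (σ (Fin.castAdd k i))) 0 (H (σ (Fin.castAdd k 0)))) *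
      P (Fin.cons d fun j => v (σ (Fin.natAdd (k + 1) j)))) := by
    by_cases hi : i = 0
    · rw [hi]
    rw [← Equiv.sum_comp (Equiv.mulRight (Equiv.swap (Fin.castAdd k i) (Fin.castAdd k 0)))]
    refine Finset.sum_congr rfl fun σ _ => ?_
    have hne : Fin.castAdd k i ≠ Fin.castAdd k 0 := by
      intro h; exact hi (Fin.castAdd_injective _ _ h)
    have h1 : (fun j => v ((σ * Equiv.swap (Fin.castAdd k i) (Fin.castAdd k 0))
        (Fin.natAdd (k + 1) j))) = fun j => v (σ (Fin.natAdd (k + 1) j)) := by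
      funext j
      rw [Equiv.Perm.mul_apply, Equiv.swap_apply_of_ne_of_ne] <;>
        · intro h
          have := congrArg Fin.val h
          simp at this
          try omega
    have h2 : Function.update (fun j => v ((σ * Equiv.swap (Fin.castAdd k i) (Fin.castAdd k 0))
        (Fin.castAdd k j))) i (H (σ (Fin.castAdd k 0))) =
        Function.update (fun j => v (σ (Fin.castAdd k j))) 0 (H (σ (Fin.castAdd k 0))) ∘
          Equiv.swap i 0 := by
      funext j
      have h3 : Equiv.swap (Fin.castAdd k i) (Fin.castAdd k 0) (Fin.castAdd k j) =
          Fin.castAdd k (Equiv.swap i 0 j) :=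
        ((Fin.castAdd_injective _ _).swap_apply _ _ _).symm ▸ rfl
      by_cases hj : j = i
      · subst hj; simp
      · have : Equiv.swap i 0 j ≠ 0 := by
          intro h
          apply hj
          have := congrArg (Equiv.swap i 0) h
          simpa using this
        rw [Function.update_of_ne hj, Function.comp_apply, Function.update_of_ne this,
          Equiv.Perm.mul_apply, h3]
    simp only [Equiv.coe_mulRight]
    rw [h1, Equiv.Perm.mul_apply, Equiv.swap_apply_left, h2, AlternatingMap.map_swap _ _ hi,
      Equiv.Perm.sign_mul, Equiv.Perm.sign_swap hne]
    simp
  simp_rw [Finset.sum_mul, Finset.mul_sum]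
  rw [Finset.sum_comm]
  simp_rw [key]
  rw [Finset.sum_const, Finset.card_univ, Fintype.card_fin, nsmul_eq_mul]
  push_cast
  rw [← Finset.mul_sum]
  congr 1
  -- A permutation is determined by the image p of the first point and a permutation τ of the
  -- remaining 2k points; the transposition of 0 and p supplies the sign -1 unless p = 0.
  refine (Equiv.sum_comp ((Equiv.permCongr (splitFirst k)).symm.trans
    Equiv.Perm.decomposeFin).symm _).symm.trans ?_
  rw [Fintype.sum_prod_type]
  refine Finset.sum_congr rfl fun p _ => ?_
  unfold altSum
  rw [Finset.mul_sum]
  refine Finset.sum_congr rfl fun τ _ => ?_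
  simp only [Equiv.symm_trans_apply, Equiv.symm_symm, Equiv.Perm.sign_permCongr,
    Equiv.permCongr_apply, splitFirst_symm_zero, splitFirst_symm_natAdd,
    Equiv.Perm.decomposeFin_symm_apply_zero, Equiv.Perm.decomposeFin.symm_sign,
    Equiv.Perm.decomposeFin_symm_apply_succ]
  have h4 : Function.update (fun i => v (splitFirst k ((Equiv.Perm.decomposeFin.symm (p, τ))
      ((splitFirst k).symm (Fin.castAdd k i))))) 0 (H (splitFirst k p)) =
      Fin.cons (H (splitFirst k p)) (fun i => v (others p (τ (Fin.castAdd k i)))) := by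
    funext i
    refine Fin.cases ?_ (fun i => ?_) i
    · simp
    · simp [splitFirst_symm_succ, others, Fin.succ_ne_zero]
  rw [h4]
  split_ifs <;>
    simp only [Units.val_mul, Units.val_neg, Units.val_one, Int.cast_mul, Int.cast_neg,
      Int.cast_one, mul_assoc] <;> rfl

theorem jacobiator_eq (P : A [⋀^Fin (k + 1)]→ₗ[ℝ] ℝ) (P' : Fin m → A [⋀^Fin (k + 1)]→ₗ[ℝ] ℝ)
    (d : Fin m → A) (v : Fin (k + 1 + k) → A) (H : Fin (k + 1 + k) → Fin m → A) :
    jacobiator P P' d v H = ∑ u, altSum (P' u) (P.curryLeft (d u)) v +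
      (k + 1) * ∑ p : Fin (k + k + 1), (if p = 0 then 1 else -1) * ∑ u,
        altSum (P.curryLeft (H (splitFirst k p) u)) (P.curryLeft (d u))
          (fun i => v (others p i)) := by
  have h := fun u => jacobiator_hessian_part P (d u) v (fun l => H l u)
  unfold jacobiator
  simp_rw [add_mul, Finset.sum_add_distrib, mul_add, Finset.sum_add_distrib]
  congr 1
  · simp_rw [Finset.mul_sum]
    rw [Finset.sum_comm]
    rfl
  · calc _ = ∑ u, (k + 1) * ∑ p : Fin (k + k + 1), (if p = 0 then 1 else -1) *
          altSum (P.curryLeft (H (splitFirst k p) u)) (P.curryLeft (d u))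
            (fun i => v (others p i)) := by
          simp_rw [← h]
          rw [Finset.sum_comm]
          simp_rw [Finset.mul_sum]
      _ = _ := by
          rw [← Finset.mul_sum, Finset.sum_comm]
          simp_rw [← Finset.mul_sum]
          ring

theorem altSum_curryLeft_sum {q : ℕ} (P : A [⋀^Fin (k + 1)]→ₗ[ℝ] ℝ) (d : Fin m → A)
    (c : Fin m → ℝ) (G : (Fin q → A) → ℝ) (x : Fin (k + q) → A) :
    altSum (P.curryLeft (∑ w, c w • d w)) G x = ∑ w, c w * altSum (P.curryLeft (d w)) G x := by
  have h (y : Fin k → A) :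
      P.curryLeft (∑ w, c w • d w) y = ∑ w, c w * P.curryLeft (d w) y := by
    simp only [map_sum, map_smul, alternatingMap_sum_apply, AlternatingMap.smul_apply, smul_eq_mul]
  simp only [altSum, h, Finset.sum_mul, Finset.mul_sum]
  rw [Finset.sum_comm]
  exact Finset.sum_congr rfl fun w _ => Finset.sum_congr rfl fun σ _ => by ring

theorem jacobiator_eq_of_hessian (P : A [⋀^Fin (k + 1)]→ₗ[ℝ] ℝ)
    (P' : Fin m → A [⋀^Fin (k + 1)]→ₗ[ℝ] ℝ) (d : Fin m → A) (v : Fin (k + 1 + k) → A)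
    (h : Fin (k + 1 + k) → Fin m → Fin m → ℝ) :
    jacobiator P P' d v (fun l u => ∑ w, h l u w • d w) =
      ∑ u, altSum (P' u) (P.curryLeft (d u)) v +
      (k + 1) * ∑ p : Fin (k + k + 1), (if p = 0 then 1 else -1) * ∑ u, ∑ w,
        h (splitFirst k p) u w * altSum (P.curryLeft (d w)) (P.curryLeft (d u))
          (fun i => v (others p i)) := by
  simp only [jacobiator_eq, altSum_curryLeft_sum]

/-- Exchanging u and w fixes the Hessian and negates the product of the contractions, so each
Hessian sum equals its own negative. -/
theorem jacobiator_of_odd (hk : Odd k) (P : A [⋀^Fin (k + 1)]→ₗ[ℝ] ℝ)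
    (P' : Fin m → A [⋀^Fin (k + 1)]→ₗ[ℝ] ℝ) (d : Fin m → A) (v : Fin (k + 1 + k) → A)
    (h : Fin (k + 1 + k) → Fin m → Fin m → ℝ) (hh : ∀ l u w, h l u w = h l w u) :
    jacobiator P P' d v (fun l u => ∑ w, h l u w • d w) =
      ∑ u, altSum (P' u) (P.curryLeft (d u)) v := by
  rw [jacobiator_eq_of_hessian, add_eq_left]
  refine mul_eq_zero_of_right _ (Finset.sum_eq_zero fun p _ => mul_eq_zero_of_right _ ?_)
  rw [← CharZero.eq_neg_self_iff]
  conv_lhs => rw [Finset.sum_comm]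
  simp only [← Finset.sum_neg_distrib]
  refine Finset.sum_congr rfl fun u _ => Finset.sum_congr rfl fun w _ => ?_
  rw [altSum_comm, hk.neg_one_pow, hh]
  ring

theorem jacobiator_of_even_iff (hk : Even k) (P : A [⋀^Fin (k + 1)]→ₗ[ℝ] ℝ)
    (P' : Fin m → A [⋀^Fin (k + 1)]→ₗ[ℝ] ℝ) (d : Fin m → A) :
    (∀ (v : Fin (k + 1 + k) → A) (h : Fin (k + 1 + k) → Fin m → Fin m → ℝ),
      (∀ l u w, h l u w = h l w u) →
        jacobiator P P' d v (fun l u => ∑ w, h l u w • d w) = 0) ↔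
    (∀ u w x, altSum (P.curryLeft (d u)) (P.curryLeft (d w)) x = 0) ∧
      ∀ v, ∑ u, altSum (P' u) (P.curryLeft (d u)) v = 0 := by
  simp only [jacobiator_eq_of_hessian]
  constructor
  · intro H
    have hD (v) : ∑ u, altSum (P' u) (P.curryLeft (d u)) v = 0 := by
      simpa using H v 0 fun _ _ _ => rfl
    refine ⟨fun u w x => ?_, hD⟩
    -- Only the first function gets a nonzero Hessian, the symmetrized elementary matrix E_uw +
    -- E_wu. Its differential is irrelevant and set to 0; the others carry x. Only p = 0 survives,
    -- and for k even its two terms agree.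
    have h1 := H (fun l => (Fin.cons 0 x : Fin (k + k + 1) → A) ((splitFirst k).symm l))
      (fun l a b => if l = splitFirst k 0 then
        (if a = u ∧ b = w then 1 else 0) + (if a = w ∧ b = u then 1 else 0) else 0)
      (fun l a b => by
        simp only [and_comm]
        split_ifs <;> simp)
    rw [hD, zero_add, mul_eq_zero, or_iff_right (by positivity), Finset.sum_eq_single 0] at h1
    · simp only [others, Equiv.swap_self, Equiv.refl_apply, Equiv.symm_apply_apply, Fin.cons_succ,
        if_true, one_mul, add_mul, Finset.sum_add_distrib, ite_and, ite_mul, zero_mul,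
        Finset.sum_ite_eq', Finset.mem_univ, Finset.sum_ite_irrel, Finset.sum_const_zero] at h1
      rw [altSum_comm (P.curryLeft (d w)), hk.neg_one_pow, one_mul] at h1
      linarith
    · intro p _ hp
      simp [hp]
    · simp
  · rintro ⟨h1, h2⟩ v h -
    simp [h1, h2]

end Jacobiator

/-! ### Decomposable multivectors as determinants -/

section WedgeVec

variable {V : Type*} [AddCommGroup V] [Module ℝ V] [TopologicalSpace V] {p q : ℕ}

/-- The wedge product as a bilinear map. -/
def wedgeBilin (V : Type*) [AddCommGroup V] [Module ℝ V] [TopologicalSpace V] (p q : ℕ) :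
    ((V →L[ℝ] ℝ) [⋀^Fin p]→ₗ[ℝ] ℝ) →ₗ[ℝ] ((V →L[ℝ] ℝ) [⋀^Fin q]→ₗ[ℝ] ℝ) →ₗ[ℝ]
      ((V →L[ℝ] ℝ) [⋀^Fin (p + q)]→ₗ[ℝ] ℝ) :=
  (TensorProduct.mk ℝ _ _).compr₂
    ((AlternatingMap.domDomCongrₗ ℝ finSumFinEquiv).toLinearMap ∘ₗ
      LinearMap.compAlternatingMapₗ ℝ (LinearMap.mul' ℝ ℝ) ∘ₗ
      (AlternatingMap.domCoprod' :
        TensorProduct ℝ ((V →L[ℝ] ℝ) [⋀^Fin p]→ₗ[ℝ] ℝ) ((V →L[ℝ] ℝ) [⋀^Fin q]→ₗ[ℝ] ℝ) →ₗ[ℝ] _))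

theorem wedgeBilin_apply (a : (V →L[ℝ] ℝ) [⋀^Fin p]→ₗ[ℝ] ℝ)
    (b : (V →L[ℝ] ℝ) [⋀^Fin q]→ₗ[ℝ] ℝ) : wedgeBilin V p q a b = wedge a b := rfl

theorem wedgeVec_apply {n : ℕ} (v : Fin n → V) (α : Fin n → V →L[ℝ] ℝ) :
    wedgeVec v α = (Matrix.of fun i j => α i (v j)).det := rfl

/-- The unsymmetrized tensor `v₁ ⊗ ⋯ ⊗ vₙ`. -/
def tensorVec {n : ℕ} (v : Fin n → V) : MultilinearMap ℝ (fun _ : Fin n => V →L[ℝ] ℝ) ℝ :=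
  (MultilinearMap.mkPiAlgebra ℝ (Fin n) ℝ).compLinearMap fun j =>
    { toFun := fun α : V →L[ℝ] ℝ => α (v j)
      map_add' := fun _ _ => rfl
      map_smul' := fun _ _ => rfl }

theorem tensorVec_apply {n : ℕ} (v : Fin n → V) (α : Fin n → V →L[ℝ] ℝ) :
    tensorVec v α = ∏ i, α i (v i) := rfl

theorem alternatization_tensorVec {n : ℕ} (v : Fin n → V) :
    MultilinearMap.alternatization (tensorVec v) = wedgeVec v := by
  ext α
  rw [MultilinearMap.alternatization_apply, wedgeVec_apply, Matrix.det_apply]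
  rfl

/-- Antisymmetrization commutes with products when both factors are antisymmetrizations of pure
tensors, so no factorials appear and the result is the Leibniz formula. -/
theorem wedge_wedgeVec (a : Fin p → V) (b : Fin q → V) :
    wedge (wedgeVec a) (wedgeVec b) = wedgeVec (Fin.append a b) := by
  ext α
  rw [← alternatization_tensorVec a, ← alternatization_tensorVec b, wedge,
    ← MultilinearMap.domCoprod_alternization, wedgeVec_apply, Matrix.det_apply,
    ← Equiv.sum_comp (Equiv.permCongr (finSumFinEquiv (m := p) (n := q)))]
  change LinearMap.mul' ℝ ℝ (MultilinearMap.alternatization _ (α ∘ finSumFinEquiv)) = _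
  rw [MultilinearMap.alternatization_apply, map_sum]
  refine Finset.sum_congr rfl fun σ _ => ?_
  rw [Equiv.Perm.sign_permCongr, Units.smul_def, map_zsmul, Units.smul_def, Fin.prod_univ_add]
  simp [Equiv.permCongr_apply, MultilinearMap.domDomCongr_apply, tensorVec_apply]

theorem wedgeVec_cons_append {k : ℕ} (w : V) (a b : Fin k → V) (α : Fin (k + k + 1) → V →L[ℝ] ℝ) :
    wedgeVec (Fin.cons w (Fin.append a b) : Fin (k + k + 1) → V) α =
      wedge (wedgeVec (Fin.cons w a : Fin (k + 1) → V)) (wedgeVec b)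
        (α ∘ (splitFirst k).symm) := by
  rw [wedge_wedgeVec, wedgeVec_apply, wedgeVec_apply,
    ← Matrix.det_submatrix_equiv_self (splitFirst k).symm]
  congr 1
  ext i j
  simp only [Matrix.submatrix_apply, Matrix.of_apply, Function.comp_apply]
  congr 1
  refine Fin.addCases (fun j => ?_) (fun j => ?_) j
  · refine Fin.cases ?_ (fun j => ?_) j
    · simp [splitFirst_symm_zero]
    · simp [splitFirst_symm_succ]
  · simp [splitFirst_symm_natAdd, -Fin.natAdd_eq_addNat]

/-- The column permutation that fixes the first column and exchanges the two blocks has the sign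
(-1)^k of the block exchange. -/
theorem wedgeVec_cons_append_comm {k : ℕ} (w : V) (a b : Fin k → V) :
    wedgeVec (Fin.cons w (Fin.append a b) : Fin (k + k + 1) → V) =
      (-1 : ℝ) ^ k • wedgeVec (Fin.cons w (Fin.append b a) : Fin (k + k + 1) → V) := by
  ext α
  rw [AlternatingMap.smul_apply, wedgeVec_apply, wedgeVec_apply]
  have h := Matrix.det_permute' (Equiv.Perm.decomposeFin.symm (0, finAddFlip))
    (Matrix.of fun i j => α i ((Fin.cons w (Fin.append b a) : Fin (k + k + 1) → V) j))
  rw [Equiv.Perm.decomposeFin.symm_sign, if_pos rfl, one_mul, sign_finAddFlip] at h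
  convert h using 2
  · ext i j
    refine Fin.cases ?_ (fun j => ?_) j
    · simp
    · simp only [Matrix.submatrix_apply, Matrix.of_apply,
        Equiv.Perm.decomposeFin_symm_apply_succ, Equiv.swap_self, Equiv.refl_apply, Fin.cons_succ]
      refine Fin.addCases (fun j => ?_) (fun j => ?_) j <;> simp [-Fin.natAdd_eq_addNat]
  · simp

theorem wedgeVec_cons_smul {n : ℕ} (c : ℝ) (w : V) (a : Fin n → V) :
    wedgeVec (Fin.cons (c • w) a : Fin (n + 1) → V) =
      c • wedgeVec (Fin.cons w a : Fin (n + 1) → V) := by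
  ext α
  rw [AlternatingMap.smul_apply, wedgeVec_apply, wedgeVec_apply, Matrix.det_succ_column_zero,
    Matrix.det_succ_column_zero, Finset.smul_sum]
  refine Finset.sum_congr rfl fun i _ => ?_
  have : (Matrix.of fun i j => α i ((Fin.cons (c • w) a : Fin (n + 1) → V) j)).submatrix
      i.succAbove Fin.succ = (Matrix.of fun i j => α i ((Fin.cons w a : Fin (n + 1) → V) j)).submatrix
      i.succAbove Fin.succ := by
    ext; simp
  rw [this]
  simp only [Matrix.of_apply, Fin.cons_zero, map_smul, smul_eq_mul]
  ring

theorem wedgeVec_cons_sub {n : ℕ} (w w' : V) (a : Fin n → V) :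
    wedgeVec (Fin.cons (w - w') a : Fin (n + 1) → V) =
      wedgeVec (Fin.cons w a : Fin (n + 1) → V) - wedgeVec (Fin.cons w' a : Fin (n + 1) → V) := by
  ext α
  rw [AlternatingMap.sub_apply, wedgeVec_apply, wedgeVec_apply, wedgeVec_apply,
    Matrix.det_succ_column_zero, Matrix.det_succ_column_zero, Matrix.det_succ_column_zero,
    ← Finset.sum_sub_distrib]
  refine Finset.sum_congr rfl fun i _ => ?_
  have hz (z : V) : (Matrix.of fun i j => α i ((Fin.cons z a : Fin (n + 1) → V) j)).submatrix
      i.succAbove Fin.succ = Matrix.of fun i' j => α (i.succAbove i') (a j) := by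
    ext; simp
  simp only [hz, Matrix.of_apply, Fin.cons_zero, map_sub]
  ring

theorem contract_wedgeVec {n : ℕ} (β : V →L[ℝ] ℝ) (v : Fin (n + 1) → V) :
    contract β (wedgeVec v) =
      ∑ j : Fin (n + 1), ((-1 : ℝ) ^ (j : ℕ) * β (v j)) • wedgeVec (fun a => v (j.succAbove a)) := by
  ext α
  rw [alternatingMap_sum_apply, contract, AlternatingMap.curryLeft_apply_apply, wedgeVec_apply, Matrix.det_succ_row_zero]
  rfl

end WedgeVec

/-! ### Coordinate expansion of multivectors -/

section Expansion

variable {m : ℕ}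

theorem dx_ddx (u w : Fin m) : dx u (ddx w) = if u = w then 1 else 0 := by
  simp [dx, ddx]

theorem sum_smul_dx (α : Euc m →L[ℝ] ℝ) : ∑ u, α (ddx u) • dx u = α := by
  ext x
  have h : x = ∑ u, x u • ddx u := by
    ext i; simp [ddx, Pi.single_apply]
  conv_rhs => rw [h]
  simp [dx, mul_comm]

/-- The basis of the dual of `ℝᵐ` formed by the coordinate covectors. -/
def dxBasis (m : ℕ) : Module.Basis (Fin m) ℝ (Euc m →L[ℝ] ℝ) :=
  Module.Basis.mk (v := dx)
    (by
      rw [Fintype.linearIndependent_iff]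
      intro g hg i
      simpa [dx_ddx] using congrArg (fun α : Euc m →L[ℝ] ℝ => α (ddx i)) hg)
    (by
      intro α _
      rw [← sum_smul_dx α]
      exact Submodule.sum_mem _ fun u _ => Submodule.smul_mem _ _ (Submodule.subset_span ⟨u, rfl⟩))

theorem wedgeVec_ddx_dx {n : ℕ} (I J : Fin n ↪o Fin m) :
    wedgeVec (fun a => ddx (I a)) (fun a => dx (J a)) = if I = J then 1 else 0 := by
  rw [wedgeVec_apply]
  split_ifs with h
  · subst h
    convert Matrix.det_one (n := Fin n) (R := ℝ)
    ext i j
    simp [dx_ddx, Matrix.one_apply]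
  -- Increasing multi-indices of equal length with nested ranges coincide; so some index of I is
  -- missing from J, which gives a zero column.
  · obtain ⟨j, hj⟩ : ∃ j, ∀ i, J i ≠ I j := by
      by_contra! hc
      apply h
      have hsub : Finset.univ.image I ⊆ Finset.univ.image J := by
        intro x hx
        obtain ⟨j, -, rfl⟩ := Finset.mem_image.1 hx
        obtain ⟨i, hi⟩ := hc j
        exact Finset.mem_image.2 ⟨i, Finset.mem_univ _, hi⟩
      have heq := Finset.eq_of_subset_of_card_le hsub (by
        rw [Finset.card_image_of_injective _ I.injective,
          Finset.card_image_of_injective _ J.injective])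
      exact OrderEmbedding.range_inj.1 (by
        simpa using congrArg (fun s : Finset (Fin m) => (s : Set (Fin m))) heq)
    exact Matrix.det_eq_zero_of_column_eq_zero j fun i => by simp [dx_ddx, hj i]

/-- It suffices to compare values on distinct basis covectors; sorting these produces the same sign
on both sides and leaves an increasing multi-index. -/
theorem eq_sum_wedgeVec {n : ℕ} (Q : (Euc m →L[ℝ] ℝ) [⋀^Fin n]→ₗ[ℝ] ℝ) :
    Q = ∑ I : Fin n ↪o Fin m, Q (fun a => dx (I a)) • wedgeVec (fun a => ddx (I a)) := by
  refine Module.Basis.ext_alternating (dxBasis m) fun v hv => ?_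
  let J : Fin n ↪o Fin m := OrderEmbedding.ofStrictMono (v ∘ Tuple.sort v)
    ((Tuple.monotone_sort v).strictMono_of_injective (hv.comp (Equiv.injective _)))
  have hJ : (fun i => dxBasis m (v i)) = (fun a => dx (J a)) ∘ ((Tuple.sort v)⁻¹ : Equiv.Perm _) := by
    funext i
    simp [J, dxBasis]
  rw [hJ, AlternatingMap.map_perm, AlternatingMap.map_perm, alternatingMap_sum_apply]
  simp [wedgeVec_ddx_dx]

end Expansion

/-! ### The bracket [P, P] in coordinates -/

section Schouten

variable {m k : ℕ} {P : Euc m → (Euc m →L[ℝ] ℝ) [⋀^Fin (k + 1)]→L[ℝ] ℝ} {y : Euc m}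

/-- The differential of the coefficient `P^I`. -/
def coeffDeriv (P : Euc m → (Euc m →L[ℝ] ℝ) [⋀^Fin (k + 1)]→L[ℝ] ℝ) (y : Euc m)
    (I : Fin (k + 1) ↪o Fin m) : Euc m →L[ℝ] ℝ :=
  fderiv ℝ (fun z => P z (fun a => dx (I a))) y

theorem coeffDeriv_apply (hP : DifferentiableAt ℝ P y) (I : Fin (k + 1) ↪o Fin m) (v : Euc m) :
    coeffDeriv P y I v = fderiv ℝ P y v (fun a => dx (I a)) := by
  rw [coeffDeriv, fderiv_continuousAlternatingMap_apply_const hP]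
  rfl

/-- Only the zeroth factor of a monomial is nonconstant, which makes most Lie brackets of factors
collapse. -/
theorem fderiv_monomialFactors (hP : DifferentiableAt ℝ P y) (I : Fin (k + 1) ↪o Fin m)
    (i : Fin (k + 1)) (v : Euc m) :
    fderiv ℝ (monomialFactors P I i) y v =
      (if i = 0 then coeffDeriv P y I v else 0) • ddx (I 0) := by
  refine Fin.cases ?_ (fun i => ?_) i
  · simp only [monomialFactors, Fin.cons_zero, if_true]
    rw [fderiv_smul_const (hP.hasFDerivAt.continuousAlternatingMap_apply_const _).differentiableAt]
    rfl
  · simp [monomialFactors, Fin.succ_ne_zero]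

theorem wedgeVec_monomialFactors (I : Fin (k + 1) ↪o Fin m) :
    wedgeVec (fun a => monomialFactors P I a y) =
      P y (fun a => dx (I a)) • wedgeVec (fun a => ddx (I a)) := by
  have h1 : (fun a => monomialFactors P I a y) =
      Fin.cons (P y (fun a => dx (I a)) • ddx (I 0)) (fun a => ddx (I a.succ)) := by
    funext a
    refine Fin.cases ?_ (fun a => ?_) a <;> simp [monomialFactors]
  have h2 : (fun a => ddx (I a)) =
      (Fin.cons (ddx (I 0)) (fun a => ddx (I a.succ)) : Fin (k + 1) → Euc m) := by
    funext a
    refine Fin.cases ?_ (fun a => ?_) a <;> simp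
  rw [h1, wedgeVec_cons_smul, ← h2]

/-- Half of the Schouten–Nijenhuis bracket of two monomials. -/
def schoutenHalf (P : Euc m → (Euc m →L[ℝ] ℝ) [⋀^Fin (k + 1)]→L[ℝ] ℝ) (y : Euc m)
    (I J : Fin (k + 1) ↪o Fin m) : (Euc m →L[ℝ] ℝ) [⋀^Fin (k + 1 + k)]→ₗ[ℝ] ℝ :=
  wedge (wedgeVec (fun a => ddx (I a))) (contract (coeffDeriv P y I)
    (P y (fun a => dx (J a)) • wedgeVec (fun a => ddx (J a))))

theorem schoutenHalf_apply (I J : Fin (k + 1) ↪o Fin m) (α : Fin (k + k + 1) → Euc m →L[ℝ] ℝ) :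
    schoutenHalf P y I J (α ∘ (splitFirst k).symm) = ∑ j : Fin (k + 1),
      (-1 : ℝ) ^ (j : ℕ) * (coeffDeriv P y I (monomialFactors P J j y) *
        wedgeVec (Fin.cons (ddx (I 0)) (Fin.append (fun a => ddx (I a.succ))
          (fun b => monomialFactors P J (j.succAbove b) y)) : Fin (k + k + 1) → Euc m) α) := by
  have h2 : (fun a => ddx (I a)) =
      (Fin.cons (ddx (I 0)) (fun a => ddx (I a.succ)) : Fin (k + 1) → Euc m) := by
    funext a
    refine Fin.cases ?_ (fun a => ?_) a <;> simp
  rw [schoutenHalf, ← wedgeVec_monomialFactors, contract_wedgeVec, ← wedgeBilin_apply, map_sum,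
    alternatingMap_sum_apply]
  refine Finset.sum_congr rfl fun j _ => ?_
  rw [map_smul, AlternatingMap.smul_apply, wedgeBilin_apply, h2, ← wedgeVec_cons_append,
    smul_eq_mul, mul_assoc]

/-- In [X_i, Y_j] = DY_j(X_i) - DX_i(Y_j), the first term survives only for j = 0 and the second
only for i = 0. In the first, the blocks must be exchanged to put the tail of J next to ∂_{J 0},
which costs (-1)^k. -/
theorem schoutenDecomposable_monomialFactors (hP : DifferentiableAt ℝ P y)
    (I J : Fin (k + 1) ↪o Fin m) (α : Fin (k + k + 1) → Euc m →L[ℝ] ℝ) :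
    schoutenDecomposable (monomialFactors P I) (monomialFactors P J) y α =
      (-1) ^ k * schoutenHalf P y J I (α ∘ (splitFirst k).symm) -
        schoutenHalf P y I J (α ∘ (splitFirst k).symm) := by
  have hsucc (I : Fin (k + 1) ↪o Fin m) : (fun b : Fin k => monomialFactors P I (Fin.succAbove 0 b) y) =
      fun a => ddx (I a.succ) := by
    funext a; simp [monomialFactors]
  rw [schoutenHalf_apply, schoutenHalf_apply, schoutenDecomposable, alternatingMap_sum_apply]
  simp_rw [alternatingMap_sum_apply, AlternatingMap.smul_apply, VectorField.lieBracket,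
    fderiv_monomialFactors hP, wedgeVec_cons_sub, wedgeVec_cons_smul, AlternatingMap.sub_apply,
    AlternatingMap.smul_apply, smul_eq_mul, mul_sub, Finset.sum_sub_distrib]
  congr 1
  · rw [Finset.mul_sum]
    refine Finset.sum_congr rfl fun i _ => ?_
    rw [Finset.sum_eq_single 0 (by intro j _ hj; simp [hj]) (by simp), hsucc,
      wedgeVec_cons_append_comm, AlternatingMap.smul_apply, if_pos rfl, smul_eq_mul]
    simp only [Fin.val_zero, add_zero]
    ring
  · rw [Finset.sum_comm]
    refine Finset.sum_congr rfl fun i _ => ?_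
    rw [Finset.sum_eq_single 0 (by intro j _ hj; simp [hj]) (by simp), hsucc, if_pos rfl]
    simp only [Fin.val_zero, zero_add]

/-- Summing over J rebuilds P in the contracted factor; writing dP^I = ∑_u ∂_u P^I dx^u and summing
over I rebuilds ∂_u P in the other. -/
theorem sum_schoutenHalf (hP : DifferentiableAt ℝ P y) :
    ∑ I, ∑ J, schoutenHalf P y I J = ∑ u, wedge (fderiv ℝ P y (ddx u)).toAlternatingMap
      (contract (dx u) (P y).toAlternatingMap) := by
  have hJ (I : Fin (k + 1) ↪o Fin m) : ∑ J, schoutenHalf P y I J =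
      wedge (wedgeVec (fun a => ddx (I a)))
        (contract (coeffDeriv P y I) (P y).toAlternatingMap) := by
    conv_rhs => rw [eq_sum_wedgeVec (P y).toAlternatingMap]
    simp only [schoutenHalf, contract, ← wedgeBilin_apply, ← AlternatingMap.curryLeftLinearMap_apply,
      map_sum, LinearMap.sum_apply]
    rfl
  have hu (u : Fin m) : (fderiv ℝ P y (ddx u)).toAlternatingMap =
      ∑ I : Fin (k + 1) ↪o Fin m, coeffDeriv P y I (ddx u) • wedgeVec (fun a => ddx (I a)) := by
    conv_lhs => rw [eq_sum_wedgeVec (fderiv ℝ P y (ddx u)).toAlternatingMap]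
    refine Finset.sum_congr rfl fun I _ => ?_
    rw [coeffDeriv_apply hP]
    rfl
  simp_rw [hJ, hu, ← wedgeBilin_apply, map_sum, LinearMap.sum_apply, map_smul, LinearMap.smul_apply]
  rw [Finset.sum_comm]
  refine Finset.sum_congr rfl fun I _ => ?_
  conv_lhs => rw [← sum_smul_dx (coeffDeriv P y I)]
  simp only [contract, map_sum, map_smul]

theorem schoutenEuc_self_apply (hP : DifferentiableAt ℝ P y)
    (α : Fin (k + k + 1) → Euc m →L[ℝ] ℝ) :
    schoutenEuc P P y α = ((-1) ^ k - 1) * (∑ u, wedge (fderiv ℝ P y (ddx u)).toAlternatingMap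
      (contract (dx u) (P y).toAlternatingMap)) (α ∘ (splitFirst k).symm) := by
  rw [← sum_schoutenHalf hP, schoutenEuc]
  simp_rw [alternatingMap_sum_apply, schoutenDecomposable_monomialFactors hP,
    Finset.sum_sub_distrib, sub_mul, one_mul, Finset.mul_sum]
  rw [Finset.sum_comm]

theorem schoutenEuc_self_eq_zero_iff (hk : Odd k) (hP : DifferentiableAt ℝ P y) :
    schoutenEuc P P y = 0 ↔ ∀ v, ∑ u, altSum (fderiv ℝ P y (ddx u))
      ((P y).toAlternatingMap.curryLeft (dx u)) v = 0 := by
  refine Iff.trans ?_ (sum_wedge_eq_zero_iff (fun u => (fderiv ℝ P y (ddx u)).toAlternatingMap)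
    (fun u => contract (dx u) (P y).toAlternatingMap))
  simp only [AlternatingMap.ext_iff, schoutenEuc_self_apply hP, hk.neg_one_pow,
    AlternatingMap.zero_apply]
  constructor
  · intro h v
    have := h (v ∘ splitFirst k)
    rw [Function.comp_assoc, Equiv.self_comp_symm, Function.comp_id] at this
    linarith
  · intro h v
    rw [h, mul_zero]

end Schouten

/-! ### Lie derivatives along constant fields -/

section LieDerivative

variable {m n : ℕ}

theorem lieDeriv_const (P : Euc m → (Euc m →L[ℝ] ℝ) [⋀^Fin n]→L[ℝ] ℝ) (w y : Euc m) :
    lieDeriv (fun _ => w) P y = fderiv ℝ P y w := by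
  have h : ContinuousLinearMap.precomp ℝ (fderiv ℝ (fun _ : Euc m => w) y) =
      (0 : (Euc m →L[ℝ] ℝ) →L[ℝ] (Euc m →L[ℝ] ℝ)) := by
    ext; simp
  rw [lieDeriv, h, map_zero]
  ext v
  exact sub_zero (fderiv ℝ P y w v)

end LieDerivative

/-! ### The Jacobi sum in a chart and functions with prescribed 2-jets -/

section Charts

theorem two_le_infty : (2 : WithTop ℕ∞) ≤ ∞ :=
  WithTop.coe_le_coe.2 (le_top : (2 : ℕ∞) ≤ ⊤)

variable {m : ℕ} {M : Type*} [TopologicalSpace M] [ChartedSpace (Euc m) M]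
  {φ : OpenPartialHomeomorph M (Euc m)}

theorem mdifferentiable_of_mem_maximalAtlas (hφ : φ ∈ IsManifold.maximalAtlas (𝓡 m) ∞ M) :
    φ.MDifferentiable (𝓡 m) (𝓡 m) :=
  ⟨(contMDiffOn_of_mem_maximalAtlas hφ).mdifferentiableOn (by simp),
    (contMDiffOn_symm_of_mem_maximalAtlas hφ).mdifferentiableOn (by simp)⟩

theorem contDiffAt_comp_symm (hφ : φ ∈ IsManifold.maximalAtlas (𝓡 m) ∞ M) {f : M → ℝ}
    (hf : ContMDiff (𝓡 m) 𝓘(ℝ) ∞ f) {y : Euc m} (hy : y ∈ φ.target) :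
    ContDiffAt ℝ ∞ (f ∘ φ.symm) y :=
  (hf.contMDiffAt.comp y (contMDiffAt_symm_of_mem_maximalAtlas hφ hy)).contDiffAt

theorem mvfderiv_symm_eq (hφ : φ ∈ IsManifold.maximalAtlas (𝓡 m) ∞ M) {f : M → ℝ} {y : Euc m}
    (hy : y ∈ φ.target) (hf : DifferentiableAt ℝ (f ∘ φ.symm) y) :
    mvfderiv (𝓡 m) f (φ.symm y) =
      (fderiv ℝ (f ∘ φ.symm) y).comp (mvfderiv (𝓡 m) φ (φ.symm y)) := by
  have hx : φ.symm y ∈ φ.source := φ.map_target hy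
  have h1 : f =ᶠ[nhds (φ.symm y)] (f ∘ φ.symm) ∘ φ := by
    filter_upwards [φ.open_source.mem_nhds hx] with z hz
    simp [φ.left_inv hz]
  have h2 := h1.mfderiv_eq (I := 𝓡 m) (I' := 𝓘(ℝ))
  have h3 : MDifferentiableAt (𝓡 m) 𝓘(ℝ) (f ∘ φ.symm) (φ (φ.symm y)) := by
    rw [φ.right_inv hy]; exact hf.mdifferentiableAt
  rw [mfderiv_comp _ h3 ((mdifferentiable_of_mem_maximalAtlas hφ).mdifferentiableAt hx),
    mfderiv_eq_fderiv, φ.right_inv hy] at h2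
  ext v
  exact congrArg (fun L => L v) h2

theorem bracket_symm_eq (hφ : φ ∈ IsManifold.maximalAtlas (𝓡 m) ∞ M) {n : ℕ}
    (P : MultivectorField m M n) {f : Fin n → M → ℝ} {y : Euc m}
    (hy : y ∈ φ.target) (hf : ∀ i, DifferentiableAt ℝ (f i ∘ φ.symm) y) :
    bracket P f (φ.symm y) = inChart P.toFun φ y (fun i => fderiv ℝ (f i ∘ φ.symm) y) := by
  simp only [bracket, mvfderiv_symm_eq hφ hy (hf _)]
  rfl

theorem differentiableAt_inChart (hφ : φ ∈ IsManifold.maximalAtlas (𝓡 m) ∞ M) {n : ℕ}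
    (P : MultivectorField m M n) {y : Euc m} (hy : y ∈ φ.target) :
    DifferentiableAt ℝ (inChart P.toFun φ) y :=
  ((P.smooth φ hφ).contDiffAt (φ.open_target.mem_nhds hy)).differentiableAt (by simp)

/-- The expression in a chart of a bracket has the expected derivative. -/
theorem hasFDerivAt_bracket (hφ : φ ∈ IsManifold.maximalAtlas (𝓡 m) ∞ M) {n : ℕ}
    (P : MultivectorField m M n) {f : Fin n → M → ℝ} (hf : ∀ i, ContMDiff (𝓡 m) 𝓘(ℝ) ∞ (f i))
    {y : Euc m} (hy : y ∈ φ.target) :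
    HasFDerivAt (bracket P f ∘ φ.symm)
      (ContinuousAlternatingMap.apply ℝ (Euc m →L[ℝ] ℝ) ℝ (fun i => fderiv ℝ (f i ∘ φ.symm) y) ∘L
          fderiv ℝ (inChart P.toFun φ) y +
        ∑ i, (inChart P.toFun φ y).toContinuousLinearMap (fun i => fderiv ℝ (f i ∘ φ.symm) y) i ∘L
          fderiv ℝ (fderiv ℝ (f i ∘ φ.symm)) y) y := by
  refine HasFDerivAt.congr_of_eventuallyEq (f := fun z =>
    inChart P.toFun φ z (fun i => fderiv ℝ (f i ∘ φ.symm) z)) ?_ ?_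
  · refine (differentiableAt_inChart hφ P hy).hasFDerivAt.continuousAlternatingMap_apply
      fun i => DifferentiableAt.hasFDerivAt ?_
    exact ((contDiffAt_comp_symm hφ (hf i) hy).fderiv_right (m := 1) (by
      rw [one_add_one_eq_two]; exact two_le_infty)).differentiableAt
      one_ne_zero
  · filter_upwards [φ.open_target.mem_nhds hy] with z hz
    exact bracket_symm_eq hφ P hz fun i =>
      (contDiffAt_comp_symm hφ (hf i) hz).differentiableAt (by simp)

/-- The left-hand side of the generalized Jacobi identity at a point. -/
def jacobiSum {k : ℕ} (P : MultivectorField m M (k + 1))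
    (f : Fin (k + 1 + k) → C^∞⟮𝓡 m, M; ℝ⟯) (x : M) : ℝ :=
  ∑ σ : Equiv.Perm (Fin (k + 1 + k)), ((Equiv.Perm.sign σ : ℤ) : ℝ) *
    bracket P (Fin.cons (bracket P (fun i : Fin (k + 1) => ⇑(f (σ (Fin.castAdd k i)))))
      (fun j : Fin k => ⇑(f (σ (Fin.natAdd (k + 1) j))))) x

/-- The jacobiator of `P` in a chart. -/
def chartJacobiator {k : ℕ} (P : MultivectorField m M (k + 1))
    (φ : OpenPartialHomeomorph M (Euc m)) (y : Euc m) (v : Fin (k + 1 + k) → Euc m →L[ℝ] ℝ)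
    (h : Fin (k + 1 + k) → Fin m → Fin m → ℝ) : ℝ :=
  jacobiator (inChart P.toFun φ y).toAlternatingMap
    (fun u => (fderiv ℝ (inChart P.toFun φ) y (ddx u)).toAlternatingMap) dx v
    (fun l u => ∑ w, h l u w • dx w)

theorem jacobiSum_symm_eq (hφ : φ ∈ IsManifold.maximalAtlas (𝓡 m) ∞ M) {k : ℕ}
    (P : MultivectorField m M (k + 1)) (f : Fin (k + 1 + k) → C^∞⟮𝓡 m, M; ℝ⟯)
    {y : Euc m} (hy : y ∈ φ.target) :
    jacobiSum P f (φ.symm y) = chartJacobiator P φ y (fun l => fderiv ℝ (f l ∘ φ.symm) y)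
      (fun l u w => fderiv ℝ (fderiv ℝ (f l ∘ φ.symm)) y (ddx u) (ddx w)) := by
  unfold jacobiSum chartJacobiator jacobiator
  refine Finset.sum_congr rfl fun σ _ => congrArg _ ?_
  have hG := hasFDerivAt_bracket hφ P (fun i => (f (σ (Fin.castAdd k i))).contMDiff) hy
  have hf (l) : DifferentiableAt ℝ (f l ∘ φ.symm) y :=
    (contDiffAt_comp_symm hφ (f l).contMDiff hy).differentiableAt (by simp)
  rw [bracket_symm_eq hφ P hy]
  · have hcons : (fun i => fderiv ℝ ((Fin.cons
        (bracket P (fun i : Fin (k + 1) => ⇑(f (σ (Fin.castAdd k i)))))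
        (fun j : Fin k => ⇑(f (σ (Fin.natAdd (k + 1) j)))) : Fin (k + 1) → M → ℝ) i ∘ φ.symm) y) =
        Fin.cons (∑ u, fderiv ℝ (bracket P (fun i : Fin (k + 1) => ⇑(f (σ (Fin.castAdd k i)))) ∘
          φ.symm) y (ddx u) • dx u)
        (fun j : Fin k => fderiv ℝ (f (σ (Fin.natAdd (k + 1) j)) ∘ φ.symm) y) := by
      rw [sum_smul_dx]
      funext i
      refine Fin.cases rfl (fun i => rfl) i
    rw [hcons]
    -- Linearity of P in its first slot turns the differential of the inner bracket into the sum
    -- over u that appears in `jacobiator`.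
    have hlin := fun β => congrArg (fun Q : (Euc m →L[ℝ] ℝ) [⋀^Fin k]→ₗ[ℝ] ℝ => Q β)
      (map_sum (inChart P.toFun φ y).toAlternatingMap.curryLeft (fun u =>
        fderiv ℝ (bracket P (fun i : Fin (k + 1) => ⇑(f (σ (Fin.castAdd k i)))) ∘
          φ.symm) y (ddx u) • dx u) Finset.univ)
    simp only [map_smul, alternatingMap_sum_apply, AlternatingMap.smul_apply] at hlin
    refine (hlin _).trans (Finset.sum_congr rfl fun u _ => ?_)
    rw [hG.fderiv, smul_eq_mul]
    simp only [sum_smul_dx]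
    congr 1
    simp only [add_apply, sum_apply]
    rfl
  · intro i
    refine Fin.cases ?_ (fun i => ?_) i
    · exact hG.differentiableAt
    · exact hf _

/-- Multiply g ∘ φ by a bump function equal to 1 near x and with closed support inside the chart
domain; the product extends smoothly by zero. -/
theorem exists_germ [T2Space M] [IsManifold (𝓡 m) ∞ M] (hφ : φ ∈ IsManifold.maximalAtlas (𝓡 m) ∞ M) {x : M}
    (hx : x ∈ φ.source) {g : Euc m → ℝ} (hg : ContDiff ℝ ∞ g) :
    ∃ f : C^∞⟮𝓡 m, M; ℝ⟯, f ∘ φ.symm =ᶠ[nhds (φ x)] g := by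
  obtain ⟨b, hb, -⟩ := (SmoothBumpFunction.nhds_basis_support (I := 𝓡 m)
    (φ.open_source.mem_nhds hx)).mem_iff.1 Filter.univ_mem
  refine ⟨⟨fun z => b z • g (φ z), contMDiff_of_tsupport fun z hz => ?_⟩, ?_⟩
  · have hz' : z ∈ φ.source := hb (tsupport_smul_subset_left _ _ hz)
    exact b.contMDiffAt.smul
      (hg.contMDiff.contMDiffAt.comp z (contMDiffAt_of_mem_maximalAtlas hφ hz'))
  · have h1 : ∀ᶠ y in nhds (φ x), b (φ.symm y) = 1 := by
      have hc := φ.continuousAt_symm (φ.map_source hx)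
      rw [ContinuousAt, φ.left_inv hx] at hc
      exact hc.eventually b.eventuallyEq_one
    filter_upwards [h1, φ.open_target.mem_nhds (φ.map_source hx)] with y hy hyt
    simp [hy, φ.right_inv hyt]

/-- A function with prescribed differential and Hessian at `y`. -/
def quadraticGerm (y : Euc m) (α : Euc m →L[ℝ] ℝ) (h : Fin m → Fin m → ℝ) (z : Euc m) : ℝ :=
  α (z - y) + 2⁻¹ * ∑ u, ∑ w, h u w * (dx u (z - y) * dx w (z - y))

theorem contDiff_quadraticGerm (y : Euc m) (α : Euc m →L[ℝ] ℝ) (h : Fin m → Fin m → ℝ) :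
    ContDiff ℝ ∞ (quadraticGerm y α h) := by
  unfold quadraticGerm
  fun_prop

theorem fderiv_quadraticGerm (y : Euc m) (α : Euc m →L[ℝ] ℝ) {h : Fin m → Fin m → ℝ}
    (hh : ∀ u w, h u w = h w u) :
    fderiv ℝ (quadraticGerm y α h) =
      fun z => α + ∑ u, ∑ w, (h u w * dx u (z - y)) • dx w := by
  funext z
  have hd (u : Fin m) : HasFDerivAt (fun z => dx u (z - y)) (dx u) z :=
    (dx u).hasFDerivAt.comp z ((hasFDerivAt_id z).sub_const y)
  have h1 : HasFDerivAt (quadraticGerm y α h) (α + (2⁻¹ : ℝ) • ∑ u, ∑ w, h u w •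
      (dx u (z - y) • dx w + dx w (z - y) • dx u)) z :=
    (α.hasFDerivAt.comp z ((hasFDerivAt_id z).sub_const y)).add
      ((HasFDerivAt.fun_sum fun u _ => HasFDerivAt.fun_sum fun w _ =>
        ((hd u).mul (hd w)).const_mul (h u w)).const_mul 2⁻¹)
  rw [h1.fderiv]
  congr 1
  have h2 : ∑ u, ∑ w, h u w • (dx w (z - y) • dx u) = ∑ u, ∑ w, h u w • (dx u (z - y) • dx w) := by
    rw [Finset.sum_comm]
    simp_rw [fun u w => hh w u]
  simp_rw [smul_add, Finset.sum_add_distrib, h2, mul_smul]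
  rw [← two_smul ℝ, smul_smul]
  norm_num

theorem fderiv_quadraticGerm_self (y : Euc m) (α : Euc m →L[ℝ] ℝ) {h : Fin m → Fin m → ℝ}
    (hh : ∀ u w, h u w = h w u) : fderiv ℝ (quadraticGerm y α h) y = α := by
  simp [fderiv_quadraticGerm y α hh]

theorem fderiv_fderiv_quadraticGerm (y : Euc m) (α : Euc m →L[ℝ] ℝ) {h : Fin m → Fin m → ℝ}
    (hh : ∀ u w, h u w = h w u) (u w : Fin m) :
    fderiv ℝ (fderiv ℝ (quadraticGerm y α h)) y (ddx u) (ddx w) = h u w := by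
  rw [fderiv_quadraticGerm y α hh]
  have hd (u : Fin m) : HasFDerivAt (fun z => dx u (z - y)) (dx u) y :=
    (dx u).hasFDerivAt.comp y ((hasFDerivAt_id y).sub_const y)
  have h1 : HasFDerivAt (fun z => α + ∑ u, ∑ w, (h u w * dx u (z - y)) • dx w)
      (∑ u, ∑ w, (h u w • dx u).smulRight (dx w)) y :=
    (HasFDerivAt.fun_sum fun u _ => HasFDerivAt.fun_sum fun w _ =>
        ((hd u).const_mul (h u w)).smul_const (dx w)).const_add α
  rw [h1.fderiv]
  simp [dx_ddx]

/-- Quadratic germs realize every choice of differentials and symmetric Hessians; conversely, second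
derivatives of smooth functions are symmetric. -/
theorem forall_jacobiSum_eq_zero_iff [T2Space M] [IsManifold (𝓡 m) ∞ M]
    (hφ : φ ∈ IsManifold.maximalAtlas (𝓡 m) ∞ M)
    {k : ℕ} (P : MultivectorField m M (k + 1)) {y : Euc m} (hy : y ∈ φ.target) :
    (∀ f, jacobiSum P f (φ.symm y) = 0) ↔
      ∀ v h, (∀ l u w, h l u w = h l w u) → chartJacobiator P φ y v h = 0 := by
  constructor
  · intro H v h hh
    have hg (l) : ∃ f : C^∞⟮𝓡 m, M; ℝ⟯, f ∘ φ.symm =ᶠ[nhds y] quadraticGerm y (v l) (h l) := by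
      have := exists_germ hφ (φ.map_target hy) (contDiff_quadraticGerm y (v l) (h l))
      rwa [φ.right_inv hy] at this
    choose f hf using hg
    have := H f
    rw [jacobiSum_symm_eq hφ P f hy] at this
    convert this using 2
    · funext l
      rw [(hf l).fderiv_eq, fderiv_quadraticGerm_self _ _ (hh l)]
    · funext l u w
      rw [(hf l).fderiv.fderiv_eq, fderiv_fderiv_quadraticGerm _ _ (hh l)]
  · intro H f
    rw [jacobiSum_symm_eq hφ P f hy]
    refine H _ _ fun l u w => ?_
    exact (contDiffAt_comp_symm hφ (f l).contMDiff hy).isSymmSndFDerivAt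
      (by simpa using two_le_infty) _ _

end Charts

/-! ### Matching the Jacobi identity with (A), (D) and [P, P] = 0 -/

section Conditions

variable {m : ℕ} {M : Type*} [TopologicalSpace M] [ChartedSpace (Euc m) M] {k : ℕ}
  {φ : OpenPartialHomeomorph M (Euc m)}

/-- The first-order part of the Jacobi identity in a chart vanishes at `y`. -/
def FirstOrderCondition (P : MultivectorField m M (k + 1)) (φ : OpenPartialHomeomorph M (Euc m))
    (y : Euc m) : Prop :=
  ∀ v, ∑ u, altSum (fderiv ℝ (inChart P.toFun φ) y (ddx u))
    ((inChart P.toFun φ y).toAlternatingMap.curryLeft (dx u)) v = 0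

theorem differentialCondition_iff (P : MultivectorField m M (k + 1)) :
    DifferentialCondition P φ ↔ ∀ y ∈ φ.target, FirstOrderCondition P φ y := by
  refine forall₂_congr fun y _ => ?_
  rw [sum_wedge_eq_zero_iff]
  simp_rw [lieDeriv_const]
  constructor
  · intro h v
    -- Exchanging the factors only permutes the arguments, which are arbitrary, so no sign has to be
    -- tracked.
    exact (Finset.sum_congr rfl fun u _ => altSum_swap _ _ _).trans (h _)
  · intro h v
    exact (Finset.sum_congr rfl fun u _ => altSum_swap _ _ _).trans (h _)

/-- The chart differential is a linear isomorphism, so transporting the coordinate bracket to the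
tangent space neither creates nor destroys zeros. -/
theorem schouten_self_eq_zero_iff [IsManifold (𝓡 m) ∞ M] (hk : Odd k)
    (P : MultivectorField m M (k + 1)) (x : M) :
    schouten P P x = 0 ↔ FirstOrderCondition P (chartAt (Euc m) x) (chartAt (Euc m) x x) := by
  have hc : chartAt (Euc m) x ∈ IsManifold.maximalAtlas (𝓡 m) ∞ M :=
    IsManifold.chart_mem_maximalAtlas x
  have hx := mem_chart_source (Euc m) x
  refine Iff.trans ?_ (schoutenEuc_self_eq_zero_iff hk
    (differentiableAt_inChart hc P ((chartAt (Euc m) x).map_source hx)))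
  let e : TangentSpace (𝓡 m) x ≃L[ℝ] Euc m := (mdifferentiable_of_mem_maximalAtlas hc).mfderiv hx
  have he : mvfderiv (𝓡 m) (chartAt (Euc m) x) x = (e : TangentSpace (𝓡 m) x →L[ℝ] Euc m) := rfl
  unfold schouten
  rw [he, ContinuousLinearMap.inverse_equiv]
  constructor
  · intro h
    ext α
    have := congrArg (fun Q => Q fun i => (α i).comp (e : TangentSpace (𝓡 m) x →L[ℝ] Euc m)) h
    refine Eq.trans (congrArg _ ?_) this
    funext i
    ext v
    simp
  · intro h
    rw [h]
    rfl

/-- The chart differential carries all covectors at the point to covectors on ℝᵐ, where bilinearity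
reduces (A) to the coordinate covectors. -/
theorem algebraicCondition_at_iff (hφ : φ ∈ IsManifold.maximalAtlas (𝓡 m) ∞ M)
    (P : MultivectorField m M (k + 1)) {y : Euc m} (hy : y ∈ φ.target) :
    (∀ α β : Cotangent m (φ.symm y), wedge (contract α (P.toFun (φ.symm y)).toAlternatingMap)
      (contract β (P.toFun (φ.symm y)).toAlternatingMap) = 0) ↔
    ∀ u w x, altSum ((inChart P.toFun φ y).toAlternatingMap.curryLeft (dx u))
      ((inChart P.toFun φ y).toAlternatingMap.curryLeft (dx w)) x = 0 := by
  have hx := φ.map_target hy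
  let e : TangentSpace (𝓡 m) (φ.symm y) ≃L[ℝ] Euc m :=
    (mdifferentiable_of_mem_maximalAtlas hφ).mfderiv hx
  have hP (v : Fin (k + 1) → Euc m →L[ℝ] ℝ) : inChart P.toFun φ y v = P.toFun (φ.symm y)
      (fun i => (v i).comp (e : TangentSpace (𝓡 m) (φ.symm y) →L[ℝ] Euc m)) := rfl
  have hcons (a : Euc m →L[ℝ] ℝ) (v : Fin k → Euc m →L[ℝ] ℝ) :
      (inChart P.toFun φ y).toAlternatingMap.curryLeft a v =
        contract (a.comp (e : TangentSpace (𝓡 m) (φ.symm y) →L[ℝ] Euc m))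
          (P.toFun (φ.symm y)).toAlternatingMap
          (fun i => (v i).comp (e : TangentSpace (𝓡 m) (φ.symm y) →L[ℝ] Euc m)) := by
    refine (hP _).trans (congrArg (P.toFun (φ.symm y)) ?_)
    funext i
    refine Fin.cases rfl (fun i => rfl) i
  have hsum (a b : Euc m →L[ℝ] ℝ) (x : Fin (k + k) → Euc m →L[ℝ] ℝ) :
      altSum ((inChart P.toFun φ y).toAlternatingMap.curryLeft a)
        ((inChart P.toFun φ y).toAlternatingMap.curryLeft b) x =
      altSum (contract (a.comp (e : TangentSpace (𝓡 m) (φ.symm y) →L[ℝ] Euc m))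
          (P.toFun (φ.symm y)).toAlternatingMap)
        (contract (b.comp (e : TangentSpace (𝓡 m) (φ.symm y) →L[ℝ] Euc m))
          (P.toFun (φ.symm y)).toAlternatingMap)
        (fun i => (x i).comp (e : TangentSpace (𝓡 m) (φ.symm y) →L[ℝ] Euc m)) := by
    simp only [altSum, hcons]
  have he (α : Cotangent m (φ.symm y)) :
      (α.comp (e.symm : Euc m →L[ℝ] TangentSpace (𝓡 m) (φ.symm y))).comp
        (e : TangentSpace (𝓡 m) (φ.symm y) →L[ℝ] Euc m) = α := by
    ext v; simp
  simp_rw [wedge_eq_zero_iff]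
  constructor
  · intro h u w x
    rw [hsum]
    exact h _ _ _
  · intro h α β x
    have h1 (a b : Euc m →L[ℝ] ℝ) (x : Fin (k + k) → Euc m →L[ℝ] ℝ) :
        altSum ((inChart P.toFun φ y).toAlternatingMap.curryLeft a)
          ((inChart P.toFun φ y).toAlternatingMap.curryLeft b) x = 0 := by
      rw [← sum_smul_dx a, altSum_curryLeft_sum]
      refine Finset.sum_eq_zero fun u _ => mul_eq_zero_of_right _ ?_
      rw [altSum_comm, ← sum_smul_dx b, altSum_curryLeft_sum]
      refine mul_eq_zero_of_right _ (Finset.sum_eq_zero fun w _ => ?_)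
      rw [h, mul_zero]
    have h2 := h1 (α.comp (e.symm : Euc m →L[ℝ] TangentSpace (𝓡 m) (φ.symm y)))
      (β.comp (e.symm : Euc m →L[ℝ] TangentSpace (𝓡 m) (φ.symm y)))
      (fun i => (x i).comp (e.symm : Euc m →L[ℝ] TangentSpace (𝓡 m) (φ.symm y)))
    rw [hsum] at h2
    simpa only [he] using h2

variable [T2Space M] [IsManifold (𝓡 m) ∞ M]

theorem jacobi_iff_of_odd (hφ : φ ∈ IsManifold.maximalAtlas (𝓡 m) ∞ M) (hk : Odd k)
    (P : MultivectorField m M (k + 1)) {y : Euc m} (hy : y ∈ φ.target) :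
    (∀ f, jacobiSum P f (φ.symm y) = 0) ↔ FirstOrderCondition P φ y := by
  rw [forall_jacobiSum_eq_zero_iff hφ P hy]
  constructor
  · intro h v
    have h0 := h v (fun _ _ _ => 0) fun _ _ _ => rfl
    rw [chartJacobiator, jacobiator_of_odd hk _ _ dx v (fun _ _ _ => 0) fun _ _ _ => rfl] at h0
    exact h0
  · intro h v H hH
    rw [chartJacobiator, jacobiator_of_odd hk _ _ dx v H hH]
    exact h v

theorem jacobi_iff_of_even (hφ : φ ∈ IsManifold.maximalAtlas (𝓡 m) ∞ M) (hk : Even k)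
    (P : MultivectorField m M (k + 1)) {y : Euc m} (hy : y ∈ φ.target) :
    (∀ f, jacobiSum P f (φ.symm y) = 0) ↔
      (∀ α β : Cotangent m (φ.symm y), wedge (contract α (P.toFun (φ.symm y)).toAlternatingMap)
        (contract β (P.toFun (φ.symm y)).toAlternatingMap) = 0) ∧ FirstOrderCondition P φ y := by
  rw [forall_jacobiSum_eq_zero_iff hφ P hy, algebraicCondition_at_iff hφ P hy]
  exact jacobiator_of_even_iff hk _ _ dx

end Conditions

end NaryPoisson

end

theorem proposition1 {m : ℕ} {M : Type*} [TopologicalSpace M] [T2Space M]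
    [ChartedSpace (EuclideanSpace ℝ (Fin m)) M] [IsManifold (𝓡 m) ∞ M]
    (k : ℕ) (hn : 3 ≤ k + 1) (P : NaryPoisson.MultivectorField m M (k + 1))
    (𝒜 : Set (OpenPartialHomeomorph M (EuclideanSpace ℝ (Fin m))))
    (h𝒜 : 𝒜 ⊆ IsManifold.maximalAtlas (𝓡 m) ∞ M)
    (hcover : ∀ x : M, ∃ φ ∈ 𝒜, x ∈ φ.source) :
    NaryPoisson.DefinesPoissonBracket P ↔
      (Even (k + 1) ∧ ∀ x : M, NaryPoisson.schouten P P x = 0) ∨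
      (Odd (k + 1) ∧ NaryPoisson.AlgebraicCondition P ∧
        ∀ φ ∈ 𝒜, NaryPoisson.DifferentialCondition P φ) := by
  have hdef : NaryPoisson.DefinesPoissonBracket P ↔
      ∀ x f, NaryPoisson.jacobiSum P f x = 0 := forall_comm
  rw [hdef]
  rcases Nat.even_or_odd k with hk | hk
  · have hodd : Odd (k + 1) := hk.add_one
    simp only [Nat.not_even_iff_odd.2 hodd, hodd, false_and, true_and, false_or]
    constructor
    · intro h
      constructor
      · intro x
        obtain ⟨φ, hφ, hx⟩ := hcover x
        have hy := φ.map_source hx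
        have := ((NaryPoisson.jacobi_iff_of_even (h𝒜 hφ) hk P hy).1 (h _)).1
        rwa [φ.left_inv hx] at this
      · intro φ hφ
        rw [NaryPoisson.differentialCondition_iff]
        intro y hy
        exact ((NaryPoisson.jacobi_iff_of_even (h𝒜 hφ) hk P hy).1 (h _)).2
    · rintro ⟨hA, hD⟩ x
      obtain ⟨φ, hφ, hx⟩ := hcover x
      have hy := φ.map_source hx
      rw [← φ.left_inv hx]
      exact (NaryPoisson.jacobi_iff_of_even (h𝒜 hφ) hk P hy).2
        ⟨hA _, (NaryPoisson.differentialCondition_iff P).1 (hD φ hφ) _ hy⟩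
  · have heven : Even (k + 1) := hk.add_one
    simp only [Nat.not_odd_iff_even.2 heven, heven, false_and, true_and, or_false]
    -- For n even the comparison is made point by point in the preferred chart, the one in which
    -- `schouten` is computed.
    refine forall_congr' fun x => ?_
    have hx := mem_chart_source (NaryPoisson.Euc m) x
    have := NaryPoisson.jacobi_iff_of_odd (IsManifold.chart_mem_maximalAtlas x) hk P
      ((chartAt (NaryPoisson.Euc m) x).map_source hx)
    rw [(chartAt (NaryPoisson.Euc m) x).left_inv hx] at this
    rw [this, NaryPoisson.schouten_self_eq_zero_iff hk]
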